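/- Let $\mathcal H_A,\mathcal H_B$ be finite-dimensional Hilbert spaces, $\log=\log_2$, and for a finite-dimensional $\mathcal H$ let $S_=(\mathcal H)$ and $S_\le(\mathcal H)$ be the sets of positive semidefinite operators $\rho$ on $\mathcal H$ with $\operatorname{tr}\rho=1$, respectively $0<\operatorname{tr}\rho\le 1$. For $\rho,\sigma\in S_\le(\mathcal H)$ let $$F(\rho,\sigma)=\operatorname{tr}\sqrt{(\sqrt\rho\sqrt\sigma)^\dagger(\sqrt\rho\sqrt\sigma)}+\sqrt{(1-\operatorname{tr}\rho)(1-\operatorname{tr}\sigma)},\qquad P(\rho,\sigma)=\sqrt{1-F(\rho,\sigma)^2},$$ and $\mathcal B^{\delta}(\rho)=\{\rho'\in S_\le(\mathcal H):P(\rho,\rho')\le\delta\}$. For positive semidefinite $\rho,\sigma$ put $D_{\max}(\rho\|\sigma)=\inf\{\lambda\in\mathbb R: \rho\le 2^{\lambda}\sigma\}$ (with $\inf\emptyset=+\infty$). Define $${}^3I_{\max}(A:B)_\rho=\inf_{\sigma_A\in S_=(\mathcal H_A),\ \sigma_B\in S_=(\mathcal H_B)}D_{\max}(\rho_{AB}\|\sigma_A\otimes\sigma_B),\qquad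 {}^3I^{\delta}_{\max}(A:B)_\rho=\inf_{\rho'\in\mathcal B^{\delta}(\rho_{AB})}{}^3I_{\max}(A:B)_{\rho'},$$ $$H_{\min}(A|B)_\rho=-\inf_{\sigma_B\in S_=(\mathcal H_B)}D_{\max}(\rho_{AB}\|\mathbb I_A\otimes\sigma_B),\qquad H^{\delta}_{\min}(A|B)_\rho=\sup_{\rho'\in\mathcal B^{\delta}(\rho_{AB})}H_{\min}(A|B)_{\rho'},$$ $$H^{\delta}_{\min}(A)_\rho=\sup_{\tau\in\mathcal B^{\delta}(\rho_A)}\bigl(-\log\lambda_{\max}(\tau)\bigr),\qquad \rho_A=\operatorname{tr}_B\rho_{AB},$$ where $\lambda_{\max}$ is the largest eigenvalue, and $$f(\varepsilon,\varepsilon')=\log\left(\frac1{1-\sqrt{1-\varepsilon^2}}+\frac1{1-\varepsilon'}\right).$$ Let $\rho\in S_=(\mathcal H_A\otimes\mathcal H_B)$, $\varepsilon>0$ and $\varepsilon'\ge0$ with $4\sqrt{2\varepsilon+2\varepsilon'}<1$. Then ${}^3I_{\max}^{\varepsilon'}(A:B)_\rho$, $H_{\min}^{\varepsilon+\varepsilon'}(A)_\rho$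 and $H_{\min}^{4\sqrt{2\varepsilon+2\varepsilon'}}(A|B)_\rho$ are finite and $${}^3I_{\max}^{\varepsilon'}(A:B)_\rho\ \ge\ H_{\min}^{\varepsilon+\varepsilon'}(A)_\rho-H_{\min}^{4\sqrt{2\varepsilon+2\varepsilon'}}(A|B)_\rho-f(\varepsilon,\varepsilon').$$ -/

import Mathlib

open scoped ComplexOrder MatrixOrder Kronecker

/-! Operators on a finite-dimensional Hilbert space with an orthonormal basis indexed by the
finite type `n` are matrices `Matrix n n ℂ`; the composite system of `a` and `b` is indexed by
`a × b`, and `≤` is the Loewner order (`A ≤ B` iff `B - A` is positive semidefinite). -/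

namespace MaxInfo

noncomputable section

/-- Normalized density operators: positive semidefinite with trace one. -/
def normalizedStates (n : Type*) [Fintype n] : Set (Matrix n n ℂ) :=
  {ρ | ρ.PosSemidef ∧ ρ.trace.re = 1}

/-- Subnormalized density operators: positive semidefinite with trace in `(0, 1]`. -/
def subnormalizedStates (n : Type*) [Fintype n] : Set (Matrix n n ℂ) :=
  {ρ | ρ.PosSemidef ∧ 0 < ρ.trace.re ∧ ρ.trace.re ≤ 1}

/-- The reduced operator on the first system: partial trace over the second one. -/
def reducedA {a b : Type*} [Fintype b] (O : Matrix (a × b) (a × b) ℂ) : Matrix a a ℂ :=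
  Matrix.of fun i j => ∑ k, O (i, k) (j, k)

section

variable {n : Type*} [Fintype n] [DecidableEq n]

/-- The trace norm `tr √(O† O)`. -/
def traceNorm (O : Matrix n n ℂ) : ℝ :=
  (CFC.sqrt (O.conjTranspose * O)).trace.re

/-- The generalized fidelity of subnormalized states. -/
def fidelity (ρ σ : Matrix n n ℂ) : ℝ :=
  traceNorm (CFC.sqrt ρ * CFC.sqrt σ) + √((1 - ρ.trace.re) * (1 - σ.trace.re))

/-- The purified distance. -/
def purifiedDistance (ρ σ : Matrix n n ℂ) : ℝ :=
  √(1 - fidelity ρ σ ^ 2)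

/-- The ball of subnormalized states that are `ε`-close to `ρ`. -/
def ball (ε : ℝ) (ρ : Matrix n n ℂ) : Set (Matrix n n ℂ) :=
  {ρ' | ρ' ∈ subnormalizedStates n ∧ purifiedDistance ρ ρ' ≤ ε}

/-- The max-relative entropy, the least real `l` with `ρ ≤ 2 ^ l • σ`;
it is `⊤` if there is no such `l`. -/
def dMax (ρ σ : Matrix n n ℂ) : EReal :=
  ⨅ (l : ℝ) (_ : ρ ≤ (2 : ℝ) ^ l • σ), (l : EReal)

/-- The largest eigenvalue of a Hermitian matrix. -/
def lambdaMax (ρ : Matrix n n ℂ) : ℝ :=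
  sSup (spectrum ℝ ρ)

/-- The min-entropy `H_min(A)` of a nonzero positive semidefinite operator on `A`. -/
def hMin (ρ : Matrix n n ℂ) : ℝ :=
  -Real.logb 2 (lambdaMax ρ)

/-- The smooth min-entropy of a state of the single system `A`. -/
def hMinSmooth (ε : ℝ) (ρ : Matrix n n ℂ) : EReal :=
  ⨆ ρ' ∈ ball ε ρ, (hMin ρ' : EReal)

end

section

variable {a b : Type*} [Fintype a] [DecidableEq a] [Fintype b] [DecidableEq b]

/-- The conditional min-entropy `H_min(A|B)`. -/
def hMinCond (ρ : Matrix (a × b) (a × b) ℂ) : EReal :=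
  -⨅ σB ∈ normalizedStates b, dMax ρ ((1 : Matrix a a ℂ) ⊗ₖ σB)

/-- The smooth conditional min-entropy. -/
def hMinCondSmooth (ε : ℝ) (ρ : Matrix (a × b) (a × b) ℂ) : EReal :=
  ⨆ ρ' ∈ ball ε ρ, hMinCond ρ'

/-- The third max-information, minimized over both marginals. -/
def iMax3 (ρ : Matrix (a × b) (a × b) ℂ) : EReal :=
  ⨅ σA ∈ normalizedStates a, ⨅ σB ∈ normalizedStates b, dMax ρ (σA ⊗ₖ σB)

/-- The smooth version of the third max-information. -/
def iMax3Smooth (ε : ℝ) (ρ : Matrix (a × b) (a × b) ℂ) : EReal :=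
  ⨅ ρ' ∈ ball ε ρ, iMax3 ρ'

end

/-- The correction term `f(ε, ε')`. -/
def corrF (ε ε' : ℝ) : ℝ :=
  Real.logb 2 (1 / (1 - √(1 - ε ^ 2)) + 1 / (1 - ε'))

end

end MaxInfo

/-! Write `η = ε + ε'`. Fix `ρ'` near `ρ` with `ρ' ≤ 2^l • σA ⊗ σB`, and `τ` near `ρ_A`. Let `P`
project onto the eigenvalues of `σA` above `t = 2^f λ_max(τ)`. Since `t tr P ≤ tr σA = 1`, the
weight `tr(Pτ) ≤ λ_max(τ) tr P` is at most `2^(-f) ≤ ε²`. Closeness in fidelity transfers this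
smallness to `ρ_A` (`sqrt_weight_le`), so removing `P ⊗ 1` from `ρ'` costs little overlap with `ρ`
(`cut_mem_ball`). The cut operator is at most `2^l t • 1 ⊗ σB`, hence `H_min(A|B)` of it is at least
`H_min(τ) - l - f` (`le_hMinCondSmooth`). Taking the infimum over `ρ'`, `σA`, `σB`, `l` and the
supremum over `τ` gives the theorem. Finiteness comes from comparing traces and from the maximally
mixed product state. -/

namespace MaxInfo

/-! ### Trace norm, polar decomposition and overlaps of square roots. -/

section TraceNorm

variable {n : Type*} [Fintype n]

theorem trace_re_nonneg {A : Matrix n n ℂ} (h : 0 ≤ A) : 0 ≤ A.trace.re :=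
  (Complex.le_def.1 (Matrix.nonneg_iff_posSemidef.1 h).trace_nonneg).1

theorem trace_re_mono {A B : Matrix n n ℂ} (h : A ≤ B) : A.trace.re ≤ B.trace.re := by
  have := trace_re_nonneg (sub_nonneg.2 h)
  rw [Matrix.trace_sub, Complex.sub_re] at this
  linarith

theorem mul_conjTranspose_nonneg (A : Matrix n n ℂ) : 0 ≤ A * A.conjTranspose :=
  Matrix.nonneg_iff_posSemidef.2 (Matrix.posSemidef_self_mul_conjTranspose A)

theorem conj_mono {A B : Matrix n n ℂ} (h : A ≤ B) (C : Matrix n n ℂ) :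
    C * A * C.conjTranspose ≤ C * B * C.conjTranspose :=
  star_right_conjugate_le_conjugate h C

theorem trace_conjTranspose_re (A : Matrix n n ℂ) : A.conjTranspose.trace.re = A.trace.re := by
  simp [Matrix.trace_conjTranspose]

/-- The Cauchy–Schwarz inequality for the Hilbert–Schmidt inner product. -/
theorem trace_mul_re_le (A B : Matrix n n ℂ) :
    (A * B).trace.re ≤
      √((A * A.conjTranspose).trace.re * (B.conjTranspose * B).trace.re) := by
  apply Real.le_sqrt_of_sq_le
  -- This quadratic in `t` is the squared Hilbert–Schmidt norm of `A + t B†`, so its discriminant is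
  -- nonpositive.
  have key : ∀ t : ℝ, 0 ≤ (B.conjTranspose * B).trace.re * (t * t) +
      (2 * (A * B).trace.re) * t + (A * A.conjTranspose).trace.re := by
    intro t
    have h := trace_re_nonneg (mul_conjTranspose_nonneg (A + (t : ℂ) • B.conjTranspose))
    have h2 : (B.conjTranspose * A.conjTranspose).trace.re = (A * B).trace.re := by
      rw [← Matrix.conjTranspose_mul, trace_conjTranspose_re]
    simp only [Matrix.conjTranspose_add, Matrix.conjTranspose_smul, Matrix.add_mul,
      Matrix.mul_add, Matrix.trace_add, Complex.add_re, Matrix.conjTranspose_conjTranspose,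
      Matrix.smul_mul, Matrix.mul_smul, Matrix.trace_smul, smul_eq_mul, Complex.star_def,
      Complex.conj_ofReal, Complex.re_ofReal_mul] at h
    rw [h2] at h
    nlinarith
  have := discrim_le_zero key
  unfold discrim at this
  nlinarith

variable [DecidableEq n]

theorem sqrt_conjTranspose (A : Matrix n n ℂ) : (CFC.sqrt A).conjTranspose = CFC.sqrt A :=
  (Matrix.nonneg_iff_posSemidef.1 (CFC.sqrt_nonneg A)).isHermitian

theorem continuousOn_spectrum (A : Matrix n n ℂ) (f : ℝ → ℝ) : ContinuousOn f (spectrum ℝ A) :=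
  Matrix.finite_real_spectrum.continuousOn f

/-- Polar decomposition: if `N N† = S ^ 2` then `N = S V` for a partial isometry `V`. -/
theorem exists_polar {S N : Matrix n n ℂ} (hS : 0 ≤ S) (h : N * N.conjTranspose = S * S) :
    ∃ V : Matrix n n ℂ, V * V.conjTranspose ≤ 1 ∧ N = S * V ∧
      V * N.conjTranspose = S := by
  have hsa : IsSelfAdjoint S := (Matrix.nonneg_iff_posSemidef.1 hS).isHermitian
  have hc := continuousOn_spectrum S
  -- Because `0⁻¹ = 0`, `T` is the pseudo-inverse of `S` and `Q = T S` its support projection; the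
  -- witness is `V = T N`.
  obtain ⟨T, hT⟩ : ∃ T, T = cfc (fun x : ℝ => x⁻¹) S := ⟨_, rfl⟩
  obtain ⟨Q, hQ⟩ : ∃ Q, Q = cfc (fun x : ℝ => x⁻¹ * x) S := ⟨_, rfl⟩
  have hTs : T.conjTranspose = T := by
    rw [hT]; exact (cfc_predicate (fun x : ℝ => x⁻¹) S :)
  have hQs : Q.conjTranspose = Q := by
    rw [hQ]; exact (cfc_predicate (fun x : ℝ => x⁻¹ * x) S :)
  have hid : cfc (fun x : ℝ => x) S = S := cfc_id' ℝ S
  have hTS : T * S = Q := by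
    rw [hQ, cfc_mul _ _ S (hc _) (hc _), hid, hT]
  have hST : S * T = Q := by
    simpa [Matrix.conjTranspose_mul, hTs, hQs, show S.conjTranspose = S from hsa] using
      congrArg Matrix.conjTranspose hTS
  have hQQ : Q * Q = Q := by
    rw [hQ, ← cfc_mul _ _ S (hc _) (hc _)]
    congr 1; ext x
    by_cases hx : x = 0 <;> simp [hx]
  have hQ1 : Q ≤ 1 := by
    rw [hQ]
    refine cfc_le_one _ S fun x _ => ?_
    by_cases hx : x = 0 <;> simp [hx]
  have hSQ : Q * S = S := by
    have : Q * S = cfc (fun x : ℝ => x⁻¹ * x * x) S := by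
      rw [cfc_mul _ _ S (hc _) (hc _), hid, hQ]
    rw [this]
    conv_rhs => rw [← hid]
    congr 1; ext x
    by_cases hx : x = 0 <;> simp [hx]
  have hQN : Q * N = N := by
    have h0 : ((1 - Q) * N) * ((1 - Q) * N).conjTranspose = 0 := by
      rw [Matrix.conjTranspose_mul, Matrix.mul_assoc, ← Matrix.mul_assoc N, h,
        ← Matrix.mul_assoc, ← Matrix.mul_assoc, sub_mul, hSQ]
      simp
    have h1 := Matrix.self_mul_conjTranspose_eq_zero.1 h0
    rw [sub_mul, one_mul, sub_eq_zero] at h1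
    exact h1.symm
  have hVN : T * N * N.conjTranspose = S := by
    rw [Matrix.mul_assoc, h, ← Matrix.mul_assoc, hTS, hSQ]
  refine ⟨T * N, ?_, ?_, hVN⟩
  · rw [Matrix.conjTranspose_mul, ← Matrix.mul_assoc, hVN, hTs, hST]
    exact hQ1
  · rw [← Matrix.mul_assoc, hST, hQN]

theorem trace_contract_le {W : Matrix n n ℂ} (hW : W * W.conjTranspose ≤ 1)
    (B : Matrix n n ℂ) :
    ((B * W).conjTranspose * (B * W)).trace.re ≤ (B * B.conjTranspose).trace.re := by
  rw [Matrix.trace_mul_comm]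
  have := trace_re_mono (conj_mono hW B)
  rw [Matrix.mul_one] at this
  rwa [Matrix.conjTranspose_mul, Matrix.mul_assoc, ← Matrix.mul_assoc W, ← Matrix.mul_assoc]

theorem contraction_mul {V W : Matrix n n ℂ} (hV : V * V.conjTranspose ≤ 1)
    (hW : W * W.conjTranspose ≤ 1) : (V * W) * (V * W).conjTranspose ≤ 1 := by
  have := conj_mono hW V
  rw [Matrix.mul_one] at this
  rw [Matrix.conjTranspose_mul, Matrix.mul_assoc, ← Matrix.mul_assoc W, ← Matrix.mul_assoc]
  exact this.trans hV

theorem exists_polar_abs (M : Matrix n n ℂ) :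
    ∃ V : Matrix n n ℂ, V * V.conjTranspose ≤ 1 ∧
      M.conjTranspose = CFC.sqrt (M.conjTranspose * M) * V ∧
      V * M = CFC.sqrt (M.conjTranspose * M) := by
  have h0 : 0 ≤ M.conjTranspose * M := by
    simpa using mul_conjTranspose_nonneg M.conjTranspose
  obtain ⟨V, h1, h2, h3⟩ := exists_polar (S := CFC.sqrt (M.conjTranspose * M))
    (N := M.conjTranspose) (CFC.sqrt_nonneg _) (by
      rw [CFC.sqrt_mul_sqrt_self _ h0, Matrix.conjTranspose_conjTranspose])
  exact ⟨V, h1, h2, by simpa using h3⟩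

/-- With `trace_mul_contraction_le` this is the variational formula: the trace norm is the maximum
of `Re tr(M W)` over contractions `W`, attained at the polar factor. -/
theorem exists_traceNorm_eq (M : Matrix n n ℂ) :
    ∃ W : Matrix n n ℂ, W * W.conjTranspose ≤ 1 ∧ (M * W).trace.re = traceNorm M := by
  obtain ⟨V, h1, -, h3⟩ := exists_polar_abs M
  exact ⟨V, h1, by rw [Matrix.trace_mul_comm, h3]; rfl⟩

theorem traceNorm_nonneg (M : Matrix n n ℂ) : 0 ≤ traceNorm M :=
  trace_re_nonneg (CFC.sqrt_nonneg _)

/-- With `M = V† S` and `S = R²`, the left side is the Hilbert–Schmidt product of `R V` and `R W`,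
each of squared norm at most `tr S`. -/
theorem trace_mul_contraction_le (M : Matrix n n ℂ) {W : Matrix n n ℂ}
    (hW : W * W.conjTranspose ≤ 1) : (M * W).trace.re ≤ traceNorm M := by
  obtain ⟨V, h1, h2, -⟩ := exists_polar_abs M
  obtain ⟨S, hS⟩ : ∃ S, S = CFC.sqrt (M.conjTranspose * M) := ⟨_, rfl⟩
  obtain ⟨R, hR⟩ : ∃ R, R = CFC.sqrt S := ⟨_, rfl⟩
  have hS0 : 0 ≤ S := hS ▸ CFC.sqrt_nonneg _
  have hRR : R * R = S := hR ▸ CFC.sqrt_mul_sqrt_self S hS0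
  have hRs : R.conjTranspose = R := hR ▸ sqrt_conjTranspose S
  have hSs : S.conjTranspose = S := hS ▸ sqrt_conjTranspose _
  have hM : M = V.conjTranspose * S := by
    rw [← Matrix.conjTranspose_conjTranspose M, h2, ← hS, Matrix.conjTranspose_mul, hSs]
  have e : (M * W).trace = ((R * V).conjTranspose * (R * W)).trace := by
    rw [hM, Matrix.conjTranspose_mul, hRs, ← hRR]
    simp only [Matrix.mul_assoc]
  have hT : traceNorm M = S.trace.re := by rw [hS]; rfl
  have b1 := trace_contract_le h1 R
  have b2 := trace_contract_le hW R
  rw [hRs, hRR] at b1 b2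
  rw [e, hT]
  refine (trace_mul_re_le _ _).trans ?_
  rw [Matrix.conjTranspose_conjTranspose]
  apply Real.sqrt_le_iff.2
  refine ⟨trace_re_nonneg hS0, ?_⟩
  rw [sq]
  refine mul_le_mul b1 b2 ?_ (trace_re_nonneg hS0)
  simpa using trace_re_nonneg (mul_conjTranspose_nonneg (R * W).conjTranspose)

/-- The overlap of `√ρ` and `√τ` inside a projection is bounded by the weights of that
projection. -/
theorem trace_sqrt_proj_le {ρ τ P W : Matrix n n ℂ} (hρ : 0 ≤ ρ) (hτ : 0 ≤ τ)
    (hP : P.conjTranspose = P) (hPP : P * P = P) (hW : W * W.conjTranspose ≤ 1) :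
    (CFC.sqrt ρ * P * CFC.sqrt τ * W).trace.re ≤
      √((P * ρ).trace.re * (P * τ).trace.re) := by
  have e : CFC.sqrt ρ * P * CFC.sqrt τ * W = (CFC.sqrt ρ * P) * ((P * CFC.sqrt τ) * W) := by
    conv_lhs => rw [← hPP]
    simp only [Matrix.mul_assoc]
  have key : ∀ σ : Matrix n n ℂ, 0 ≤ σ →
      ((P * CFC.sqrt σ) * (P * CFC.sqrt σ).conjTranspose).trace = (P * σ).trace := by
    intro σ hσ
    rw [Matrix.conjTranspose_mul, sqrt_conjTranspose, hP, Matrix.mul_assoc,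
      ← Matrix.mul_assoc (CFC.sqrt σ), CFC.sqrt_mul_sqrt_self σ hσ, ← Matrix.mul_assoc,
      Matrix.trace_mul_comm, ← Matrix.mul_assoc, hPP]
  rw [e]
  refine (trace_mul_re_le _ _).trans (Real.sqrt_le_sqrt ?_)
  have e1 : ((CFC.sqrt ρ * P) * (CFC.sqrt ρ * P).conjTranspose).trace = (P * ρ).trace := by
    rw [← key ρ hρ, Matrix.trace_mul_comm (P * _)]
    simp only [Matrix.conjTranspose_mul, sqrt_conjTranspose, hP]
  have e2 := trace_contract_le hW (P * CFC.sqrt τ)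
  rw [key τ hτ] at e2
  rw [e1]
  refine mul_le_mul_of_nonneg_left e2 ?_
  rw [← key ρ hρ]
  exact trace_re_nonneg (mul_conjTranspose_nonneg _)

theorem one_sub_proj {P : Matrix n n ℂ} (hP : P.conjTranspose = P) (hPP : P * P = P) :
    (1 - P).conjTranspose = 1 - P ∧ (1 - P) * (1 - P) = 1 - P := by
  constructor
  · simp [hP]
  · simp [sub_mul, mul_sub, hPP]

/-- Measuring `{P, 1 - P}` cannot decrease fidelity: insert `P + (1 - P)` between the roots at the
optimal contraction. -/
theorem traceNorm_sqrt_le_proj {ρ τ P : Matrix n n ℂ} (hρ : 0 ≤ ρ) (hτ : 0 ≤ τ)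
    (hP : P.conjTranspose = P) (hPP : P * P = P) :
    traceNorm (CFC.sqrt ρ * CFC.sqrt τ) ≤ √((P * ρ).trace.re * (P * τ).trace.re) +
      √(((1 - P) * ρ).trace.re * ((1 - P) * τ).trace.re) := by
  obtain ⟨W, hW, h⟩ := exists_traceNorm_eq (CFC.sqrt ρ * CFC.sqrt τ)
  obtain ⟨hG, hGG⟩ := one_sub_proj hP hPP
  have a1 := trace_sqrt_proj_le hρ hτ hP hPP hW
  have a2 := trace_sqrt_proj_le hρ hτ hG hGG hW
  rw [← h]
  have : (CFC.sqrt ρ * CFC.sqrt τ * W) =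
      CFC.sqrt ρ * P * CFC.sqrt τ * W + CFC.sqrt ρ * (1 - P) * CFC.sqrt τ * W := by
    noncomm_ring
  rw [this, Matrix.trace_add, Complex.add_re]
  exact add_le_add a1 a2

theorem traceNorm_sqrt_le {ρ τ : Matrix n n ℂ} (hρ : 0 ≤ ρ) (hτ : 0 ≤ τ) :
    traceNorm (CFC.sqrt ρ * CFC.sqrt τ) ≤ √(ρ.trace.re * τ.trace.re) := by
  simpa using traceNorm_sqrt_le_proj hρ hτ (P := 1) (by simp) (by simp)

/-- Cutting `ρ` down by a projection of large weight changes its overlap with `σ` only a little. -/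
theorem traceNorm_sqrt_cut {σ ρ P : Matrix n n ℂ} (hσ : 0 ≤ σ) (hρ : 0 ≤ ρ)
    (hP : P.conjTranspose = P) (hPP : P * P = P) :
    traceNorm (CFC.sqrt σ * CFC.sqrt ρ) - √((P * σ).trace.re * (P * ρ).trace.re) ≤
      traceNorm (CFC.sqrt σ * CFC.sqrt ((1 - P) * ρ * (1 - P).conjTranspose)) := by
  obtain ⟨W, hW, h⟩ := exists_traceNorm_eq (CFC.sqrt σ * CFC.sqrt ρ)
  have h0 : 0 ≤ (1 - P) * ρ * (1 - P).conjTranspose := by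
    simpa using conj_mono hρ (1 - P)
  obtain ⟨κ, hκ⟩ : ∃ κ, κ = (1 - P) * ρ * (1 - P).conjTranspose := ⟨_, rfl⟩
  rw [← hκ] at h0 ⊢
  -- Both `(1 - P)√ρ` and `√κ` are square roots of `κ` in the sense `N N† = κ`, so they differ by a
  -- contraction `V`; `V W` is then a test operator for the cut overlap.
  have hSS : ((1 - P) * CFC.sqrt ρ) * ((1 - P) * CFC.sqrt ρ).conjTranspose =
      CFC.sqrt κ * CFC.sqrt κ := by
    rw [CFC.sqrt_mul_sqrt_self κ h0, Matrix.conjTranspose_mul, sqrt_conjTranspose,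
      Matrix.mul_assoc, ← Matrix.mul_assoc (CFC.sqrt ρ), CFC.sqrt_mul_sqrt_self ρ hρ,
      ← Matrix.mul_assoc, hκ]
  obtain ⟨V, hV, hN, -⟩ := exists_polar (CFC.sqrt_nonneg κ) hSS
  have b := trace_mul_contraction_le (CFC.sqrt σ * CFC.sqrt κ) (contraction_mul hV hW)
  have a := trace_sqrt_proj_le hσ hρ hP hPP hW
  have e : CFC.sqrt σ * CFC.sqrt κ * (V * W) =
      CFC.sqrt σ * CFC.sqrt ρ * W - CFC.sqrt σ * P * CFC.sqrt ρ * W := by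
    rw [Matrix.mul_assoc, ← Matrix.mul_assoc _ V W, ← hN]
    noncomm_ring
  rw [e, Matrix.trace_sub, Complex.sub_re, h] at b
  linarith

theorem traceNorm_sqrt_self {ρ : Matrix n n ℂ} (hρ : 0 ≤ ρ) :
    traceNorm (CFC.sqrt ρ * CFC.sqrt ρ) = ρ.trace.re := by
  have hs : ρ.conjTranspose = ρ := (Matrix.nonneg_iff_posSemidef.1 hρ).isHermitian
  rw [CFC.sqrt_mul_sqrt_self ρ hρ, traceNorm, hs, CFC.sqrt_mul_self ρ hρ]

end TraceNorm

/-! ### Largest eigenvalue and spectral cuts. -/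

section Spectral

variable {n : Type*} [Fintype n]

theorem trace_real_smul_re (r : ℝ) (A : Matrix n n ℂ) : (r • A).trace.re = r * A.trace.re := by
  rw [Matrix.trace_smul, Complex.smul_re, smul_eq_mul]

theorem card_pos_of_trace {τ : Matrix n n ℂ} (ht : 0 < τ.trace.re) :
    (0 : ℝ) < Fintype.card n := by
  rcases isEmpty_or_nonempty n with hn | hn
  · simp [Matrix.trace] at ht
  · exact_mod_cast Fintype.card_pos

theorem trace_proj_mul_mono {P A B : Matrix n n ℂ} (hP : P.conjTranspose = P) (hPP : P * P = P)
    (h : A ≤ B) : (P * A).trace.re ≤ (P * B).trace.re := by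
  have key : ∀ C : Matrix n n ℂ, (P * C * P.conjTranspose).trace = (P * C).trace := by
    intro C
    rw [hP, Matrix.trace_mul_comm, ← Matrix.mul_assoc, hPP]
  have := trace_re_mono (conj_mono h P)
  rwa [key, key] at this

theorem trace_proj_mul_nonneg {P A : Matrix n n ℂ} (hP : P.conjTranspose = P) (hPP : P * P = P)
    (h : 0 ≤ A) : 0 ≤ (P * A).trace.re := by
  simpa using trace_proj_mul_mono hP hPP h

variable [DecidableEq n]

theorem le_lambdaMax_smul {τ : Matrix n n ℂ} (h : 0 ≤ τ) :
    τ ≤ lambdaMax τ • (1 : Matrix n n ℂ) := by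
  have hsa : IsSelfAdjoint τ := (Matrix.nonneg_iff_posSemidef.1 h).isHermitian
  rw [← Algebra.algebraMap_eq_smul_one]
  exact le_algebraMap_of_spectrum_le
    (fun x hx => le_csSup Matrix.finite_real_spectrum.bddAbove hx) hsa

theorem trace_re_le_lambdaMax {τ : Matrix n n ℂ} (h : 0 ≤ τ) :
    τ.trace.re ≤ lambdaMax τ * Fintype.card n := by
  have := trace_re_mono (le_lambdaMax_smul h)
  rwa [trace_real_smul_re, Matrix.trace_one, Complex.natCast_re] at this

theorem lambdaMax_pos {τ : Matrix n n ℂ} (h : 0 ≤ τ) (ht : 0 < τ.trace.re) :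
    0 < lambdaMax τ :=
  pos_of_mul_pos_left (ht.trans_le (trace_re_le_lambdaMax h)) (card_pos_of_trace ht).le

/-- The spectral projection of `σ` onto its eigenvalues above the threshold `t`. -/
theorem exists_spectral_cut {σ : Matrix n n ℂ} (hσ : 0 ≤ σ) {t : ℝ} (ht : 0 ≤ t) :
    ∃ P : Matrix n n ℂ, P.conjTranspose = P ∧ P * P = P ∧ t • P ≤ σ ∧
      (1 - P) * σ * (1 - P).conjTranspose ≤ t • (1 : Matrix n n ℂ) := by
  have hsa : IsSelfAdjoint σ := (Matrix.nonneg_iff_posSemidef.1 hσ).isHermitian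
  have hc := continuousOn_spectrum σ
  have hid : cfc (fun x : ℝ => x) σ = σ := cfc_id' ℝ σ
  have hpos : ∀ x ∈ spectrum ℝ σ, 0 ≤ x := fun x hx => spectrum_nonneg_of_nonneg hσ hx
  let p : ℝ → ℝ := fun x => if t < x then 1 else 0
  obtain ⟨P, hP⟩ : ∃ P, P = cfc p σ := ⟨_, rfl⟩
  have hPs : P.conjTranspose = P := by
    rw [hP]; exact (cfc_predicate p σ :)
  have hG : 1 - P = cfc (fun x => 1 - p x) σ := by
    rw [cfc_sub (fun _ => (1 : ℝ)) p σ (hc _) (hc _), cfc_const_one ℝ σ, hP]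
  refine ⟨P, hPs, ?_, ?_, ?_⟩
  · rw [hP, ← cfc_mul _ _ σ (hc _) (hc _)]
    congr 1; ext x
    by_cases hx : t < x <;> simp [p, hx]
  · rw [hP, ← cfc_smul t p σ (hc _)]
    conv_rhs => rw [← hid]
    refine cfc_mono (fun x hx => ?_) (hc _) (hc _)
    by_cases h : t < x
    · simp [p, h, h.le]
    · simpa [p, h] using hpos x hx
  · have : (1 - P) * σ * (1 - P).conjTranspose =
        cfc (fun x => (1 - p x) * x * (1 - p x)) σ := by
      rw [cfc_mul _ _ σ (hc _) (hc _), cfc_mul _ _ σ (hc _) (hc _), hid, ← hG]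
      simp [hPs]
    rw [this, ← Algebra.algebraMap_eq_smul_one]
    refine cfc_le_algebraMap _ t σ (fun x hx => ?_) (hc _)
    by_cases h : t < x
    · simpa [p, h] using ht
    · simpa only [p, if_neg h, sub_zero, one_mul, mul_one] using not_lt.1 h

theorem trace_one_sub_proj_mul_re (P A : Matrix n n ℂ) :
    ((1 - P) * A).trace.re = A.trace.re - (P * A).trace.re := by
  simp [sub_mul, Matrix.trace_sub]

theorem trace_proj_mul_le {P A : Matrix n n ℂ} (hP : P.conjTranspose = P) (hPP : P * P = P)
    (h : 0 ≤ A) : (P * A).trace.re ≤ A.trace.re := by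
  obtain ⟨h1, h2⟩ := one_sub_proj hP hPP
  have := trace_proj_mul_nonneg h1 h2 h
  rw [trace_one_sub_proj_mul_re] at this
  linarith

theorem le_trace_smul_one {A : Matrix n n ℂ} (h : 0 ≤ A) :
    A ≤ A.trace.re • (1 : Matrix n n ℂ) := by
  have hA := Matrix.nonneg_iff_posSemidef.1 h
  refine (le_lambdaMax_smul h).trans ?_
  have hle : lambdaMax A ≤ A.trace.re := by
    refine Real.sSup_le (fun x hx => ?_) (trace_re_nonneg h)
    rw [hA.isHermitian.spectrum_real_eq_range_eigenvalues] at hx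
    obtain ⟨i, rfl⟩ := hx
    rw [hA.isHermitian.trace_eq_sum_eigenvalues]
    simp only [Complex.re_sum, Complex.coe_algebraMap, Complex.ofReal_re]
    simpa using Finset.single_le_sum (f := hA.isHermitian.eigenvalues)
      (fun j _ => hA.eigenvalues_nonneg j) (Finset.mem_univ i)
  rw [← sub_nonneg, ← sub_smul]
  exact smul_nonneg (sub_nonneg.2 hle) zero_le_one

end Spectral

/-! ### Purified-distance balls around normalized states. -/

section Ball

variable {n : Type*} [Fintype n]

theorem nonneg_of_mem_normalizedStates {ρ : Matrix n n ℂ} (h : ρ ∈ normalizedStates n) :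
    0 ≤ ρ := Matrix.nonneg_iff_posSemidef.2 h.1

theorem mem_subnormalizedStates_of_normalized {ρ : Matrix n n ℂ} (h : ρ ∈ normalizedStates n) :
    ρ ∈ subnormalizedStates n :=
  ⟨h.1, by rw [h.2]; exact one_pos, h.2.le⟩

variable [DecidableEq n]

theorem nonneg_of_mem_ball {δ : ℝ} {ρ ρ' : Matrix n n ℂ} (h : ρ' ∈ ball δ ρ) : 0 ≤ ρ' :=
  Matrix.nonneg_iff_posSemidef.2 h.1.1

theorem fidelity_of_normalized {ρ : Matrix n n ℂ} (h : ρ ∈ normalizedStates n)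
    (σ : Matrix n n ℂ) : fidelity ρ σ = traceNorm (CFC.sqrt ρ * CFC.sqrt σ) := by
  simp [fidelity, h.2]

theorem self_mem_ball {δ : ℝ} (hδ : 0 ≤ δ) {ρ : Matrix n n ℂ} (h : ρ ∈ normalizedStates n) :
    ρ ∈ ball δ ρ := by
  refine ⟨mem_subnormalizedStates_of_normalized h, ?_⟩
  rw [purifiedDistance, fidelity_of_normalized h,
    traceNorm_sqrt_self (nonneg_of_mem_normalizedStates h), h.2]
  simpa using hδ

theorem one_sub_sq_le_of_mem_ball {δ : ℝ} (hδ : 0 ≤ δ) {ρ ρ' : Matrix n n ℂ}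
    (hρ : ρ ∈ normalizedStates n) (h : ρ' ∈ ball δ ρ) :
    1 - δ ^ 2 ≤ traceNorm (CFC.sqrt ρ * CFC.sqrt ρ') ^ 2 := by
  have := (Real.sqrt_le_left hδ).1 h.2
  rw [fidelity_of_normalized hρ] at this
  linarith

theorem traceNorm_sq_le_trace {ρ ρ' : Matrix n n ℂ} (hρ : ρ ∈ normalizedStates n)
    (h : 0 ≤ ρ') : traceNorm (CFC.sqrt ρ * CFC.sqrt ρ') ^ 2 ≤ ρ'.trace.re := by
  have h1 := traceNorm_sqrt_le (nonneg_of_mem_normalizedStates hρ) h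
  rw [hρ.2, one_mul] at h1
  exact (Real.le_sqrt (traceNorm_nonneg _) (trace_re_nonneg h)).1 h1

theorem one_sub_sq_le_trace_of_mem_ball {δ : ℝ} (hδ : 0 ≤ δ) {ρ ρ' : Matrix n n ℂ}
    (hρ : ρ ∈ normalizedStates n) (h : ρ' ∈ ball δ ρ) : 1 - δ ^ 2 ≤ ρ'.trace.re :=
  (one_sub_sq_le_of_mem_ball hδ hρ h).trans (traceNorm_sq_le_trace hρ (nonneg_of_mem_ball h))

/-- A projection of small weight in `τ` has small weight in every nearby normalized state. -/
theorem sqrt_weight_le {η : ℝ} (hη : 0 ≤ η) (hη1 : η < 1 / 32) {ρ τ P : Matrix n n ℂ}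
    (hρ : ρ ∈ normalizedStates n) (hτ : τ ∈ ball η ρ) (hP : P.conjTranspose = P)
    (hPP : P * P = P) (hw : (P * τ).trace.re ≤ η ^ 2) : √(P * ρ).trace.re ≤ 3 * η := by
  have hρ0 := nonneg_of_mem_normalizedStates hρ
  have hτ0 := nonneg_of_mem_ball hτ
  have h1 := one_sub_sq_le_of_mem_ball hη hρ hτ
  have h2 := traceNorm_sqrt_le_proj hρ0 hτ0 hP hPP
  have hw0 := trace_proj_mul_nonneg hP hPP hρ0
  have hw1 := trace_proj_mul_le hP hPP hρ0
  have hv0 := trace_proj_mul_nonneg hP hPP hτ0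
  rw [trace_one_sub_proj_mul_re, trace_one_sub_proj_mul_re, hρ.2] at h2
  rw [hρ.2] at hw1
  generalize (P * ρ).trace.re = w at *
  generalize (P * τ).trace.re = v at *
  have h3 : √(w * v) ≤ √w * η := by
    rw [Real.sqrt_mul hw0]
    exact mul_le_mul_of_nonneg_left ((Real.sqrt_le_left hη).2 hw) (Real.sqrt_nonneg _)
  have h4 : √((1 - w) * (τ.trace.re - v)) ≤ √(1 - w) := by
    apply Real.sqrt_le_sqrt
    have := hτ.1.2.2
    nlinarith
  have h5 := h2.trans (add_le_add h3 h4)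
  have h6 := pow_le_pow_left₀ (traceNorm_nonneg _) h5 2
  have hs1 := Real.sq_sqrt hw0
  have hs2 := Real.sq_sqrt (sub_nonneg.2 hw1)
  have hx := Real.sqrt_nonneg w
  have hy := Real.sqrt_nonneg (1 - w)
  have hy1 : √(1 - w) ≤ 1 := Real.sqrt_le_one.2 (by linarith)
  generalize √w = x at *
  generalize √(1 - w) = y at *
  by_contra hcon
  push Not at hcon
  -- Expand `1 - η² ≤ (xη + y)²` with `y² = 1 - x²` and `y ≤ 1`. If `x > 3η`, the right side is
  -- below `(1/9 + 2/3 + 1/1024) x² < x²`.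
  have h7 : x ^ 2 ≤ η ^ 2 + 2 * x * η + x ^ 2 * η ^ 2 := by
    nlinarith [mul_nonneg hx hη]
  have h8 : η ^ 2 ≤ (1 / 32) ^ 2 := by gcongr
  nlinarith

end Ball

/-! ### Partial trace and Kronecker products. -/

section Reduced

/-- Lets a projection on `A` be weighed equally well in the joint state and in its marginal. -/
theorem trace_kronecker_one_mul {a b : Type*} [Fintype a] [Fintype b] [DecidableEq b]
    (P : Matrix a a ℂ) (O : Matrix (a × b) (a × b) ℂ) :
    ((P ⊗ₖ (1 : Matrix b b ℂ)) * O).trace = (P * reducedA O).trace := by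
  simp only [Matrix.trace, Matrix.diag, Matrix.mul_apply, Matrix.kroneckerMap_apply,
    Fintype.sum_prod_type, reducedA, Matrix.of_apply, Matrix.one_apply, Finset.mul_sum]
  refine Finset.sum_congr rfl fun i _ => ?_
  rw [Finset.sum_comm]
  simp

theorem trace_reducedA {a b : Type*} [Fintype a] [DecidableEq a] [Fintype b] [DecidableEq b]
    (O : Matrix (a × b) (a × b) ℂ) : (reducedA O).trace = O.trace := by
  simpa using (trace_kronecker_one_mul 1 O).symm

theorem reducedA_posSemidef {a b : Type*} [Fintype b]
    {O : Matrix (a × b) (a × b) ℂ} (h : O.PosSemidef) :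
    (reducedA O).PosSemidef := by
  have : reducedA O = ∑ k, O.submatrix (fun i => (i, k)) (fun i => (i, k)) := by
    ext i j
    simp [reducedA, Matrix.sum_apply]
  rw [this]
  exact Matrix.posSemidef_sum _ fun k _ => h.submatrix _

theorem reducedA_mem_normalizedStates {a b : Type*} [Fintype a] [DecidableEq a] [Fintype b] [DecidableEq b]
    {ρ : Matrix (a × b) (a × b) ℂ}
    (h : ρ ∈ normalizedStates (a × b)) : reducedA ρ ∈ normalizedStates a :=
  ⟨reducedA_posSemidef h.1, by rw [trace_reducedA]; exact h.2⟩

theorem kronecker_mono_left {a b : Type*} [Fintype a] [Fintype b]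
    {A A' : Matrix a a ℂ} {B : Matrix b b ℂ} (h : A ≤ A') (hB : 0 ≤ B) :
    A ⊗ₖ B ≤ A' ⊗ₖ B := by
  rw [← sub_nonneg, Matrix.nonneg_iff_posSemidef]
  have := (Matrix.le_iff.1 h).kronecker (Matrix.nonneg_iff_posSemidef.1 hB)
  convert this using 1
  ext i j
  simp [sub_mul]

theorem proj_kronecker_one {a b : Type*} [Fintype a] [Fintype b] [DecidableEq b]
    {P : Matrix a a ℂ} (hP : P.conjTranspose = P) (hPP : P * P = P) :
    (P ⊗ₖ (1 : Matrix b b ℂ)).conjTranspose = P ⊗ₖ 1 ∧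
      (P ⊗ₖ (1 : Matrix b b ℂ)) * (P ⊗ₖ 1) = P ⊗ₖ 1 := by
  constructor
  · rw [Matrix.conjTranspose_kronecker, hP, Matrix.conjTranspose_one]
  · rw [← Matrix.mul_kronecker_mul, hPP, one_mul]

end Reduced

/-! ### Entropy bounds, the key inequality and finiteness. -/

section Entropies

theorem dMax_le {n : Type*} [Fintype n] [DecidableEq n] {ρ σ : Matrix n n ℂ} {l : ℝ}
    (h : ρ ≤ (2 : ℝ) ^ l • σ) : dMax ρ σ ≤ (l : EReal) :=
  iInf₂_le l h

/-- Obtained by taking traces in `ρ ≤ 2^l • σ`; it supplies the finiteness bounds involving `dMax`.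
-/
theorem le_dMax {n : Type*} [Fintype n] [DecidableEq n] {ρ σ : Matrix n n ℂ} {m : ℝ}
    (hm : 0 < m) (hσ : 0 < σ.trace.re) (h : m * σ.trace.re ≤ ρ.trace.re) :
    (Real.logb 2 m : EReal) ≤ dMax ρ σ := by
  refine le_iInf₂ fun l hl => EReal.coe_le_coe_iff.2 ?_
  have h1 := trace_re_mono hl
  rw [trace_real_smul_re] at h1
  rw [Real.logb_le_iff_le_rpow one_lt_two hm]
  exact le_of_mul_le_mul_right (h.trans h1) hσ

theorem two_rpow_neg_hMin {n : Type*} [Fintype n] [DecidableEq n] {τ : Matrix n n ℂ}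
    (h : 0 ≤ τ) (ht : 0 < τ.trace.re) : (2 : ℝ) ^ (-hMin τ) = lambdaMax τ := by
  rw [hMin, neg_neg, Real.rpow_logb two_pos (by norm_num) (lambdaMax_pos h ht)]

theorem one_sub_sqrt_one_sub_sq_pos {ε : ℝ} (hε : 0 < ε) : 0 < 1 - √(1 - ε ^ 2) := by
  rw [sub_pos, Real.sqrt_lt' one_pos]
  nlinarith

theorem one_sub_sqrt_one_sub_sq_le {ε : ℝ} (h1 : ε ≤ 1) (hε : 0 < ε) :
    1 - √(1 - ε ^ 2) ≤ ε ^ 2 := by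
  have h0 : 0 ≤ 1 - ε ^ 2 := by nlinarith
  have : 1 - ε ^ 2 ≤ √(1 - ε ^ 2) := by
    apply Real.le_sqrt_of_sq_le
    nlinarith
  linarith

/-- The correction matters only through `2^f ≥ ε⁻²`. The first summand already gives this; the
second is positive and only enlarges `2^f`. -/
theorem exists_two_rpow_corrF {ε ε' : ℝ} (hε : 0 < ε) (hε1 : ε ≤ 1) (hε' : ε' < 1) :
    ∃ c : ℝ, 0 < c ∧ 1 / c ≤ ε ^ 2 ∧ (2 : ℝ) ^ corrF ε ε' = c := by
  have h1 := one_sub_sqrt_one_sub_sq_pos hε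
  have h2 := one_sub_sqrt_one_sub_sq_le hε1 hε
  have h3 : 0 < 1 / (1 - ε') := one_div_pos.2 (sub_pos.2 hε')
  have h4 : 0 < 1 / (1 - √(1 - ε ^ 2)) := one_div_pos.2 h1
  have h5 : 0 < 1 / (1 - √(1 - ε ^ 2)) + 1 / (1 - ε') := add_pos h4 h3
  refine ⟨_, h5, ?_, ?_⟩
  · refine le_trans ?_ h2
    rw [one_div_le h5 h1]
    linarith
  · rw [corrF, Real.rpow_logb two_pos (by norm_num) h5]

variable {a b : Type*} [Fintype a] [DecidableEq a] [Fintype b] [DecidableEq b]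

/-- Cutting off a projection of small weight on `A` stays within the ball. -/
theorem cut_mem_ball {ρ ρ' : Matrix (a × b) (a × b) ℂ} {P : Matrix a a ℂ} {ε' η : ℝ}
    (hρ : ρ ∈ normalizedStates (a × b)) (hε' : 0 ≤ ε') (hη : ε' ≤ η) (hη0 : 0 < η)
    (hη1 : η < 1 / 32) (hρ' : ρ' ∈ ball ε' ρ) (hP : P.conjTranspose = P) (hPP : P * P = P)
    (hw : √(P * reducedA ρ).trace.re ≤ 3 * η) :
    ((1 - P) ⊗ₖ (1 : Matrix b b ℂ)) * ρ' * ((1 - P) ⊗ₖ (1 : Matrix b b ℂ)).conjTranspose ∈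
      ball (4 * √(2 * η)) ρ := by
  obtain ⟨hQ, hQQ⟩ := proj_kronecker_one (b := b) hP hPP
  have hPQ : (1 - P) ⊗ₖ (1 : Matrix b b ℂ) = 1 - P ⊗ₖ (1 : Matrix b b ℂ) := by
    ext i j
    by_cases h1 : i.1 = j.1 <;> by_cases h2 : i.2 = j.2 <;>
      simp [Matrix.one_apply, Prod.ext_iff, h1, h2]
  rw [hPQ]
  rw [← trace_kronecker_one_mul (b := b)] at hw
  generalize P ⊗ₖ (1 : Matrix b b ℂ) = Q at *
  have hρ0 := nonneg_of_mem_normalizedStates hρ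
  have hρ0' := nonneg_of_mem_ball hρ'
  have h1 := one_sub_sq_le_of_mem_ball hε' hρ hρ'
  have h2 := traceNorm_sq_le_trace hρ hρ0'
  have h3 := traceNorm_sqrt_cut hρ0 hρ0' hQ hQQ
  have h4 := traceNorm_nonneg (CFC.sqrt ρ * CFC.sqrt ρ')
  have hw' : √((Q * ρ).trace.re * (Q * ρ').trace.re) ≤ 3 * η := by
    refine le_trans (Real.sqrt_le_sqrt ?_) hw
    exact mul_le_of_le_one_right (trace_proj_mul_nonneg hQ hQQ hρ0)
      ((trace_proj_mul_le hQ hQQ hρ0').trans hρ'.1.2.2)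
  obtain ⟨hG, hGG⟩ := one_sub_proj hQ hQQ
  obtain ⟨κ, hκ⟩ : ∃ κ, κ = (1 - Q) * ρ' * (1 - Q).conjTranspose := ⟨_, rfl⟩
  have hκ0 : 0 ≤ κ := by simpa [hκ] using conj_mono hρ0' (1 - Q)
  have hκ1 : κ.trace.re ≤ 1 := by
    rw [hκ, hG, Matrix.trace_mul_comm, ← Matrix.mul_assoc, hGG]
    exact (trace_proj_mul_le hG hGG hρ0').trans hρ'.1.2.2
  rw [← hκ] at h3 ⊢
  have h5 := traceNorm_sq_le_trace hρ hκ0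
  have h2' := h2.trans hρ'.1.2.2
  have h6 : traceNorm (CFC.sqrt ρ * CFC.sqrt ρ') - 3 * η ≤
      traceNorm (CFC.sqrt ρ * CFC.sqrt κ) := by linarith
  have hF := fidelity_of_normalized hρ κ
  generalize traceNorm (CFC.sqrt ρ * CFC.sqrt ρ') = x at *
  generalize traceNorm (CFC.sqrt ρ * CFC.sqrt κ) = y at *
  have hx1 : x ≤ 1 := by nlinarith
  have hx2 : 1 / 2 ≤ x := by nlinarith
  have hy : 1 / 4 ≤ y := by linarith
  -- `x² ≥ 1 - η²` and `x ≤ 1` give `(x - 3η)² ≥ 1 - 6η`, so there is room to spare; `32η` is the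
  -- square of the radius `4√(2η)`.
  have h7 : 1 - 32 * η ≤ y ^ 2 := by
    have : (x - 3 * η) ^ 2 ≤ y ^ 2 := pow_le_pow_left₀ (by linarith) h6 2
    nlinarith
  refine ⟨⟨Matrix.nonneg_iff_posSemidef.1 hκ0, ?_, hκ1⟩, ?_⟩
  · nlinarith
  · rw [purifiedDistance, hF, Real.sqrt_le_left (by positivity), mul_pow,
      Real.sq_sqrt (by positivity)]
    linarith

/-- The main inequality before any optimization; the candidate in the outer ball is `ρ'` cut by `(1
- P) ⊗ 1`. -/
theorem le_hMinCondSmooth {ρ ρ' : Matrix (a × b) (a × b) ℂ} {σA τ : Matrix a a ℂ}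
    {σB : Matrix b b ℂ} {ε ε' l : ℝ} (hρ : ρ ∈ normalizedStates (a × b)) (hε : 0 < ε)
    (hε' : 0 ≤ ε') (hη1 : ε + ε' < 1 / 32) (hρ' : ρ' ∈ ball ε' ρ)
    (hσA : σA ∈ normalizedStates a) (hσB : σB ∈ normalizedStates b)
    (hl : ρ' ≤ (2 : ℝ) ^ l • (σA ⊗ₖ σB)) (hτ : τ ∈ ball (ε + ε') (reducedA ρ)) :
    ((hMin τ - l - corrF ε ε' : ℝ) : EReal) ≤ hMinCondSmooth (4 * √(2 * (ε + ε'))) ρ := by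
  obtain ⟨c, hc0, hc1, hc⟩ := exists_two_rpow_corrF hε (by linarith) (by linarith : ε' < 1)
  have hτ0 := nonneg_of_mem_ball hτ
  have hσA0 := nonneg_of_mem_normalizedStates hσA
  have hσB0 := nonneg_of_mem_normalizedStates hσB
  have hlam := lambdaMax_pos hτ0 hτ.1.2.1
  -- This threshold equals `2^(f - H_min(τ))`: high enough that `P` has `τ`-weight at most `1/c`,
  -- and exactly the loss allowed in the final bound.
  have ht : 0 < c * lambdaMax τ := mul_pos hc0 hlam
  obtain ⟨P, hP, hPP, hPσ, hG⟩ := exists_spectral_cut hσA0 ht.le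
  have hPt : c * lambdaMax τ * P.trace.re ≤ 1 := by
    rw [← trace_real_smul_re, ← hσA.2]
    exact trace_re_mono hPσ
  have hPτ : (P * τ).trace.re ≤ (ε + ε') ^ 2 := by
    have h1 := trace_proj_mul_mono hP hPP (le_lambdaMax_smul hτ0)
    rw [Matrix.mul_smul, mul_one, trace_real_smul_re] at h1
    have h2 : lambdaMax τ * P.trace.re ≤ 1 / c := by
      rw [le_div_iff₀ hc0]
      linarith
    have h3 : ε ^ 2 ≤ (ε + ε') ^ 2 := by gcongr; linarith
    linarith
  have hw := sqrt_weight_le (by linarith) hη1 (reducedA_mem_normalizedStates hρ) hτ hP hPP hPτ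
  have hmem := cut_mem_ball hρ hε' (by linarith) (by linarith) hη1 hρ' hP hPP hw
  refine le_trans ?_ (le_iSup₂ (f := fun κ (_ : κ ∈ ball (4 * √(2 * (ε + ε'))) ρ) =>
    hMinCond κ) _ hmem)
  rw [hMinCond, EReal.le_neg, ← EReal.coe_neg]
  refine (iInf₂_le σB hσB).trans (dMax_le ?_)
  have e : (2 : ℝ) ^ (-(hMin τ - l - corrF ε ε')) = 2 ^ l * (c * lambdaMax τ) := by
    rw [← hc, ← two_rpow_neg_hMin hτ0 hτ.1.2.1, ← Real.rpow_add two_pos, ← Real.rpow_add two_pos]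
    congr 1; ring
  rw [e, mul_smul, ← Matrix.smul_kronecker]
  refine (conj_mono hl _).trans ?_
  rw [Matrix.mul_smul, Matrix.smul_mul, Matrix.conjTranspose_kronecker,
    ← Matrix.mul_kronecker_mul, ← Matrix.mul_kronecker_mul]
  refine smul_le_smul_of_nonneg_left ?_ (by positivity)
  simpa using kronecker_mono_left hG hσB0

theorem trace_eq_one_of_mem_normalizedStates {n : Type*} [Fintype n] {σ : Matrix n n ℂ}
    (h : σ ∈ normalizedStates n) : σ.trace = 1 :=
  Complex.ext h.2 (Complex.le_def.1 h.1.trace_nonneg).2.symm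

theorem le_iMax3Smooth {ρ : Matrix (a × b) (a × b) ℂ} {δ : ℝ} (hδ : 0 ≤ δ) (hδ1 : δ < 1)
    (hρ : ρ ∈ normalizedStates (a × b)) :
    (Real.logb 2 (1 - δ ^ 2) : EReal) ≤ iMax3Smooth δ ρ := by
  refine le_iInf₂ fun ρ' hρ' => le_iInf₂ fun σA hσA => le_iInf₂ fun σB hσB => ?_
  have h : (σA ⊗ₖ σB).trace.re = 1 := by
    rw [Matrix.trace_kronecker, trace_eq_one_of_mem_normalizedStates hσA,
      trace_eq_one_of_mem_normalizedStates hσB]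
    simp
  refine le_dMax (by nlinarith) (by rw [h]; exact one_pos) ?_
  rw [h, mul_one]
  exact one_sub_sq_le_trace_of_mem_ball hδ hρ hρ'

/-- States in the ball have trace at least `1 - δ²`, while `1 ⊗ σB` has trace `dim A`. -/
theorem hMinCondSmooth_le {ρ : Matrix (a × b) (a × b) ℂ} {δ : ℝ} (hδ : 0 ≤ δ) (hδ1 : δ < 1)
    (hρ : ρ ∈ normalizedStates (a × b)) :
    hMinCondSmooth δ ρ ≤ ((-Real.logb 2 ((1 - δ ^ 2) / Fintype.card a) : ℝ) : EReal) := by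
  have ha : (0 : ℝ) < Fintype.card a := card_pos_of_trace (τ := reducedA ρ) (by
    rw [trace_reducedA, hρ.2]; exact one_pos)
  refine iSup₂_le fun ρ' hρ' => ?_
  rw [hMinCond, EReal.coe_neg, EReal.neg_le_neg_iff]
  refine le_iInf₂ fun σB hσB => ?_
  have h : ((1 : Matrix a a ℂ) ⊗ₖ σB).trace.re = (Fintype.card a : ℝ) := by
    rw [Matrix.trace_kronecker, trace_eq_one_of_mem_normalizedStates hσB]
    simp
  refine le_dMax (div_pos (by nlinarith) ha) (by rw [h]; exact ha) ?_
  rw [h, div_mul_cancel₀ _ ha.ne']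
  exact one_sub_sq_le_trace_of_mem_ball hδ hρ hρ'

theorem hMinSmooth_le {n : Type*} [Fintype n] [DecidableEq n] {ρ : Matrix n n ℂ} {δ : ℝ}
    (hδ : 0 ≤ δ) (hδ1 : δ < 1) (hρ : ρ ∈ normalizedStates n) :
    hMinSmooth δ ρ ≤ ((-Real.logb 2 ((1 - δ ^ 2) / Fintype.card n) : ℝ) : EReal) := by
  have hn : (0 : ℝ) < Fintype.card n := card_pos_of_trace (τ := ρ) (by
    rw [hρ.2]; exact one_pos)
  refine iSup₂_le fun τ hτ => EReal.coe_le_coe_iff.2 (neg_le_neg ?_)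
  refine Real.logb_le_logb_of_le one_lt_two (div_pos (by nlinarith) hn) ?_
  rw [div_le_iff₀ hn]
  exact (one_sub_sq_le_trace_of_mem_ball hδ hρ hτ).trans
    (trace_re_le_lambdaMax (nonneg_of_mem_ball hτ))

theorem exists_normalizedState_smul_eq_one {n : Type*} [Fintype n] [DecidableEq n] [Nonempty n] :
    ∃ σ ∈ normalizedStates n, (Fintype.card n : ℝ) • σ = 1 := by
  have hn : (0 : ℝ) < Fintype.card n := by exact_mod_cast Fintype.card_pos
  refine ⟨(Fintype.card n : ℝ)⁻¹ • 1, ⟨?_, ?_⟩, ?_⟩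
  · rw [← Matrix.nonneg_iff_posSemidef]
    exact smul_nonneg (by positivity) zero_le_one
  · rw [trace_real_smul_re, Matrix.trace_one, Complex.natCast_re, inv_mul_cancel₀ hn.ne']
  · rw [smul_smul, mul_inv_cancel₀ hn.ne', one_smul]

/-- Every normalized bipartite state is dominated by a multiple of a product state. -/
theorem exists_le_smul_kronecker {ρ : Matrix (a × b) (a × b) ℂ}
    (hρ : ρ ∈ normalizedStates (a × b)) :
    ∃ σA ∈ normalizedStates a, ∃ σB ∈ normalizedStates b, ∃ l : ℝ,
      ρ ≤ (2 : ℝ) ^ l • (σA ⊗ₖ σB) := by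
  have hab : (0 : ℝ) < Fintype.card (a × b) := card_pos_of_trace (τ := ρ) (by
    rw [hρ.2]; exact one_pos)
  have hne : Nonempty (a × b) := Fintype.card_pos_iff.1 (by exact_mod_cast hab)
  have : Nonempty a := hne.map Prod.fst
  have : Nonempty b := hne.map Prod.snd
  obtain ⟨σA, hA, hA1⟩ := exists_normalizedState_smul_eq_one (n := a)
  obtain ⟨σB, hB, hB1⟩ := exists_normalizedState_smul_eq_one (n := b)
  refine ⟨σA, hA, σB, hB, Real.logb 2 (Fintype.card (a × b)), ?_⟩
  rw [Real.rpow_logb two_pos (by norm_num) hab, Fintype.card_prod, Nat.cast_mul, mul_smul,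
    ← Matrix.kronecker_smul, hB1, ← Matrix.smul_kronecker, hA1, Matrix.one_kronecker_one]
  simpa [hρ.2] using le_trace_smul_one (nonneg_of_mem_normalizedStates hρ)

end Entropies

end MaxInfo

open MaxInfo in
theorem mainTheorem7 {a b : Type*} [Fintype a] [DecidableEq a] [Fintype b] [DecidableEq b]
    (ρ : Matrix (a × b) (a × b) ℂ) (hρ : ρ ∈ MaxInfo.normalizedStates (a × b))
    (ε ε' : ℝ) (hε : 0 < ε) (hε' : 0 ≤ ε')
    (hsmall : 4 * √(2 * ε + 2 * ε') < 1) :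
    ∃ i h hc : ℝ,
      MaxInfo.iMax3Smooth ε' ρ = (i : EReal) ∧
      MaxInfo.hMinSmooth (ε + ε') (MaxInfo.reducedA ρ) = (h : EReal) ∧
      MaxInfo.hMinCondSmooth (4 * √(2 * ε + 2 * ε')) ρ = (hc : EReal) ∧
      i ≥ h - hc - MaxInfo.corrF ε ε' := by
  -- Squaring the smallness hypothesis gives `32 (ε + ε') < 1`.
  have hη1 : ε + ε' < 1 / 32 := by
    have h1 : √(2 * ε + 2 * ε') < 1 / 4 := by linarith
    rw [Real.sqrt_lt' (by norm_num)] at h1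
    linarith
  have hη : 0 ≤ ε + ε' := by linarith
  have hρA := reducedA_mem_normalizedStates hρ
  have key := @le_hMinCondSmooth a b _ _ _ _ ρ
  rw [← mul_add] at hsmall ⊢
  obtain ⟨σA, hA, σB, hB, l, hl⟩ := exists_le_smul_kronecker hρ
  have hiT : iMax3Smooth ε' ρ ≠ ⊤ := ne_top_of_le_ne_top (EReal.coe_ne_top l) <|
    (iInf₂_le ρ (self_mem_ball hε' hρ)).trans <|
    (iInf₂_le σA hA).trans <| (iInf₂_le σB hB).trans (dMax_le hl)
  have hiB : iMax3Smooth ε' ρ ≠ ⊥ :=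
    ne_bot_of_le_ne_bot (EReal.coe_ne_bot _) (le_iMax3Smooth hε' (by linarith) hρ)
  have hhT : hMinSmooth (ε + ε') (reducedA ρ) ≠ ⊤ :=
    ne_top_of_le_ne_top (EReal.coe_ne_top _) (hMinSmooth_le hη (by linarith) hρA)
  have hhB : hMinSmooth (ε + ε') (reducedA ρ) ≠ ⊥ :=
    ne_bot_of_le_ne_bot (EReal.coe_ne_bot _)
      (le_iSup₂ (f := fun τ (_ : τ ∈ ball (ε + ε') (reducedA ρ)) => (hMin τ : EReal)) _
        (self_mem_ball hη hρA))
  have hcT : hMinCondSmooth (4 * √(2 * (ε + ε'))) ρ ≠ ⊤ :=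
    ne_top_of_le_ne_top (EReal.coe_ne_top _) (hMinCondSmooth_le (by positivity) hsmall hρ)
  -- The key inequality at `ρ' = ρ`, `τ = ρ_A` and the maximally mixed product already gives a
  -- finite lower bound.
  have hcB : hMinCondSmooth (4 * √(2 * (ε + ε'))) ρ ≠ ⊥ :=
    ne_bot_of_le_ne_bot (EReal.coe_ne_bot _)
      (key hρ hε hε' hη1 (self_mem_ball hε' hρ) hA hB hl (self_mem_ball hη hρA))
  have hi := EReal.coe_toReal hiT hiB
  have hh := EReal.coe_toReal hhT hhB
  have hc := EReal.coe_toReal hcT hcB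
  refine ⟨_, _, _, hi.symm, hh.symm, hc.symm, ?_⟩
  generalize (iMax3Smooth ε' ρ).toReal = i at *
  generalize (hMinSmooth (ε + ε') (reducedA ρ)).toReal = h at *
  generalize (hMinCondSmooth (4 * √(2 * (ε + ε'))) ρ).toReal = c at *
  rw [ge_iff_le, ← EReal.coe_le_coe_iff, hi]
  refine le_iInf₂ fun ρ' hρ' => le_iInf₂ fun σA hσA => le_iInf₂ fun σB hσB =>
    le_iInf₂ fun l hl => EReal.coe_le_coe_iff.2 ?_
  have hle : (h : EReal) ≤ ((l + c + corrF ε ε' : ℝ) : EReal) := by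
    rw [hh]
    refine iSup₂_le fun τ hτ => EReal.coe_le_coe_iff.2 ?_
    have := key hρ hε hε' hη1 hρ' hσA hσB hl hτ
    rw [← hc, EReal.coe_le_coe_iff] at this
    linarith
  rw [EReal.coe_le_coe_iff] at hle
  linarith
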